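/- Let $d\ge 1$, let $\Omega\subseteq\mathbb R^d$ be a bounded open set with Lebesgue measure $|\Omega|$, let $\mathbf M_1,\dots,\mathbf M_N$ be real symmetric positive definite $d\times d$ matrices, and let $\lambda_1(\mathbf M_j)>0$ denote the smallest eigenvalue of $\mathbf M_j$. Let $q_1,\dots,q_N$ be real numbers with $\sum_{j=1}^N q_j=|\Omega|$, let $f_1,\dots,f_m\in H^{-1}(\Omega)=H^1_0(\Omega)'$, and let $\mu_1,\dots,\mu_m>0$. Put $$K=\Big\{\vartheta\in[0,1]^N:\ \sum_{j=1}^N\vartheta_j=1\Big\},\qquad \frac1{\lambda_-(\vartheta)}=\sum_{j=1}^N\frac{\vartheta_j}{\lambda_1(\mathbf M_j)}\quad(\vartheta\in K),$$ $$\mathcal T=\Big\{\theta\in L^\infty(\Omega;K):\ \int_\Omega\theta_j\,dx=q_j,\ j=1,\dots,N\Big\},$$ $$\mathcal S=\big\{\sigma\in L^2(\Omega;\mathbb R^d)^m:\ -\operatorname{div}\sigma_i=f_i \text{ in the sense of distributions on }\Omega,\ i=1,\dots,m\big\}.$$ Let $\theta\in\mathcal T$. Then for each $i=1,\dots,m$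 the state equation $$-\operatorname{div}(\lambda_-(\theta)\nabla u_i)=f_i,\qquad u_i\in H^1_0(\Omega),$$ has a unique solution $u_i$. Set $I(\theta)=\sum_{i=1}^m\mu_i\langle f_i,u_i\rangle$, where $\langle\cdot,\cdot\rangle$ is the duality pairing between $H^{-1}(\Omega)$ and $H^1_0(\Omega)$. Then $$I(\theta)=\min_{\sigma\in\mathcal S}\ \sum_{i=1}^m\mu_i\int_\Omega\frac{|\sigma_i|^2}{\lambda_-(\theta)}\,dx ,$$ where all the integrals are finite, and the minimum is attained at exactly one $\sigma\in\mathcal S$, namely the one given by $\sigma_i=\lambda_-(\theta)\nabla u_i$, $i=1,\dots,m$. -/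

import Mathlib

open MeasureTheory Set TopologicalSpace
open scoped ENNReal Gradient Distributions

noncomputable section

namespace OptDesign

/-- `ℝ^d` with the Euclidean norm. -/
abbrev Space (d : ℕ) : Type := EuclideanSpace ℝ (Fin d)

/-- Lebesgue measure on `Ω`. -/
abbrev vol {d : ℕ} (Ω : Opens (Space d)) : Measure (Space d) :=
  (volume : Measure (Space d)).restrict (Ω : Set (Space d))

/-- `L²(Ω)`. -/
abbrev L2 {d : ℕ} (Ω : Opens (Space d)) : Type := Lp ℝ 2 (vol Ω)

/-- `L²(Ω; ℝ^d)`. -/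
abbrev L2Vec {d : ℕ} (Ω : Opens (Space d)) : Type := Lp (Space d) 2 (vol Ω)

/-- `L²(Ω) × L²(Ω; ℝ^d)` as a Hilbert space. -/
abbrev L2Pair {d : ℕ} (Ω : Opens (Space d)) : Type := WithLp 2 (L2 Ω × L2Vec Ω)

section TestFunctions

variable {d : ℕ} {Ω : Opens (Space d)}

theorem test_differentiable (φ : 𝓓(Ω, ℝ)) : Differentiable ℝ φ :=
  φ.contDiff.differentiable (by simp)

theorem test_memLp (φ : 𝓓(Ω, ℝ)) : MemLp φ 2 (vol Ω) :=
  φ.continuous.memLp_of_hasCompactSupport φ.hasCompactSupport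

theorem test_gradient_memLp (φ : 𝓓(Ω, ℝ)) : MemLp (∇ φ) 2 (vol Ω) := by
  have hc : Continuous (∇ (φ : Space d → ℝ)) :=
    (InnerProductSpace.toDual ℝ (Space d)).symm.continuous.comp
      (φ.contDiff.continuous_fderiv (by simp))
  refine hc.memLp_of_hasCompactSupport ?_
  exact (φ.hasCompactSupport.fderiv (𝕜 := ℝ)).comp_left
    (g := (InnerProductSpace.toDual ℝ (Space d)).symm) (map_zero _)

theorem test_gradient_add (φ ψ : 𝓓(Ω, ℝ)) : ∇ (φ + ψ : 𝓓(Ω, ℝ)) = ∇ φ + ∇ ψ := by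
  funext x
  have h : ((φ + ψ : 𝓓(Ω, ℝ)) : Space d → ℝ) = (φ : Space d → ℝ) + ψ := rfl
  simp only [gradient, Pi.add_apply, h]
  rw [fderiv_add (test_differentiable φ x) (test_differentiable ψ x), map_add]

theorem test_gradient_smul (c : ℝ) (φ : 𝓓(Ω, ℝ)) : ∇ (c • φ : 𝓓(Ω, ℝ)) = c • ∇ φ := by
  funext x
  have h : ((c • φ : 𝓓(Ω, ℝ)) : Space d → ℝ) = c • (φ : Space d → ℝ) := rfl
  simp only [gradient, Pi.smul_apply, h]
  rw [fderiv_const_smul (test_differentiable φ x), map_smul]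

variable (Ω) in
/-- The map `φ ↦ (φ, ∇φ)` from `C_c^∞(Ω)` to `L²(Ω) × L²(Ω; ℝ^d)`. -/
def testPair : 𝓓(Ω, ℝ) →ₗ[ℝ] L2Pair Ω where
  toFun φ := WithLp.toLp 2
    ((test_memLp φ).toLp φ, (test_gradient_memLp φ).toLp (∇ φ))
  map_add' φ ψ := by
    simp only [test_gradient_add]
    rfl
  map_smul' c φ := by
    simp only [test_gradient_smul]
    rfl

end TestFunctions

section Sobolev

variable {d : ℕ}

/-- `H¹₀(Ω)`, the closure of `C_c^∞(Ω)` in the norm `(‖u‖² + ‖∇u‖²)^{1/2}`.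
An element is stored as the pair `(u, ∇u)` in `L²(Ω) × L²(Ω; ℝ^d)`. -/
def H10 (Ω : Opens (Space d)) : Submodule ℝ (L2Pair Ω) :=
  (LinearMap.range (testPair Ω)).topologicalClosure

/-- `H⁻¹(Ω)`, the topological dual of `H¹₀(Ω)`. -/
abbrev Hneg1 (Ω : Opens (Space d)) : Type := StrongDual ℝ (H10 Ω)

/-- A test function as an element of `H¹₀(Ω)`. -/
def testH10 {Ω : Opens (Space d)} (φ : 𝓓(Ω, ℝ)) : H10 Ω :=
  ⟨testPair Ω φ, Submodule.le_topologicalClosure _ (LinearMap.mem_range_self _ φ)⟩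

/-- The (weak) gradient of `u ∈ H¹₀(Ω)`. -/
def grad {Ω : Opens (Space d)} (u : H10 Ω) : L2Vec Ω := (u : L2Pair Ω).snd

/-- `-div σ = f` in the sense of distributions on `Ω`, for `f ∈ H⁻¹(Ω)`:
`∫_Ω σ · ∇φ = ⟨f, φ⟩` for every `φ ∈ C_c^∞(Ω)`. -/
def NegDivEq (Ω : Opens (Space d)) (σ : Space d → Space d) (f : Hneg1 Ω) : Prop :=
  ∀ φ : 𝓓(Ω, ℝ), ∫ x in (Ω : Set (Space d)), inner ℝ (σ x) (∇ φ x) = f (testH10 φ)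

end Sobolev

section Materials

variable {d N : ℕ}

/-- The smallest eigenvalue `λ₁(M)` of a real symmetric matrix (of size `d ≥ 1`). -/
def minEigenvalue {M : Matrix (Fin d) (Fin d) ℝ} (hM : M.IsHermitian) : ℝ :=
  ⨅ k, hM.eigenvalues k

/-- `λ₋(ϑ)`, the weighted harmonic mean: `1 / λ₋(ϑ) = ∑ j, ϑ_j / λ₁(M_j)`. -/
def lambdaMinus {M : Fin N → Matrix (Fin d) (Fin d) ℝ} (hM : ∀ j, (M j).PosDef)
    (ϑ : Fin N → ℝ) : ℝ :=
  (∑ j, ϑ j / minEigenvalue (hM j).isHermitian)⁻¹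

/-- The set `𝒯` of admissible local proportions: (classes of) measurable `θ` on `Ω` with values
a.e. in the simplex `K = {ϑ ∈ [0,1]^N : ∑ ϑ_j = 1}` and `∫_Ω θ_j = q_j`. -/
def IsAdmissible (Ω : Opens (Space d)) (q : Fin N → ℝ) (θ : Space d → Fin N → ℝ) : Prop :=
  AEStronglyMeasurable θ (vol Ω) ∧
  (∀ᵐ x ∂(vol Ω), θ x ∈ stdSimplex ℝ (Fin N)) ∧
  ∀ j, ∫ x in (Ω : Set (Space d)), θ x j = q j

end Materials

section Energies

variable {d N m : ℕ} (Ω : Opens (Space d)) {M : Fin N → Matrix (Fin d) (Fin d) ℝ}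
  (hM : ∀ j, (M j).PosDef)

/-- `u ∈ H¹₀(Ω)` solves the state equation `-div (λ₋(θ) ∇u) = f` in `Ω`. -/
def IsState (θ : Space d → Fin N → ℝ) (f : Hneg1 Ω) (u : H10 Ω) : Prop :=
  NegDivEq Ω (fun x => lambdaMinus hM (θ x) • grad u x) f

/-- The energy `∑ i, μ_i ⟨f_i, u_i⟩`; evaluated at the states `u_i` associated with `θ`,
this is `I(θ)`. -/
def energy (μ : Fin m → ℝ) (f : Fin m → Hneg1 Ω) (u : Fin m → H10 Ω) : ℝ :=
  ∑ i, μ i * f i (u i)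

/-- The set `𝒮` of fluxes `σ ∈ L²(Ω; ℝ^d)^m` with `-div σ_i = f_i`. -/
def fluxes (f : Fin m → Hneg1 Ω) : Set (Fin m → L2Vec Ω) :=
  {σ | ∀ i, NegDivEq Ω (σ i) (f i)}

/-- `H(θ, σ) = ∑ i, μ_i ∫_Ω |σ_i|² / λ₋(θ)`. -/
def fluxEnergy (μ : Fin m → ℝ) (θ : Space d → Fin N → ℝ) (σ : Fin m → L2Vec Ω) : ℝ :=
  ∑ i, μ i * ∫ x in (Ω : Set (Space d)), ‖σ i x‖ ^ 2 / lambdaMinus hM (θ x)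

end Energies

end OptDesign

end

/-! Write `a` for `λ₋(θ)`, which lies a.e. between two positive constants. For the state `u` and a
competing flux `τ`, completing the square gives `|τ|²/a = 2 τ·∇u - a|∇u|² + |τ - a∇u|²/a` pointwise.
Both `τ` and `a∇u` have divergence `-f`, so testing with `u` itself turns the integral of the first
two terms into `2f(u) - f(u) = f(u)` (`integral_flux_expansion`). The remainder is nonnegative and,
since `1/a` is bounded below, vanishes only at `τ = a∇u`. Summing with the positive weights `μ_i`
gives both the minimum and its uniqueness.

Unique solvability is Lax–Milgram (`existsUnique_weak_solution`), with coercivity from the Poincaré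
inequality (`exists_norm_le_grad`). Density of test functions in `H¹₀`
(`negDivEq_iff_forall_inner_grad`) is what allows `u` as a test function. -/

noncomputable section

namespace OptDesign

/-! ### Poincaré inequality on a bounded open set -/

section Poincare

variable {d : ℕ} {Ω : Opens (Space d)}

theorem test_eq_zero_of_notMem (φ : 𝓓(Ω, ℝ)) {x : Space d} (hx : x ∉ Ω) : φ x = 0 :=
  image_eq_zero_of_notMem_tsupport fun h => hx (φ.tsupport_subset h)

theorem fderiv_eq_inner_gradient (φ : Space d → ℝ) (x v : Space d) :
    fderiv ℝ φ x v = inner ℝ (∇ φ x) v := by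
  simp [gradient]

theorem test_continuous_fderiv_apply (φ : 𝓓(Ω, ℝ)) (v : Space d) :
    Continuous fun x => fderiv ℝ φ x v :=
  (φ.contDiff.continuous_fderiv (by simp)).clm_apply continuous_const

theorem fderiv_coord_mul {φ : Space d → ℝ} (hφ : Differentiable ℝ φ) (i : Fin d) (x : Space d) :
    fderiv ℝ (fun y : Space d => y i * φ y) x (EuclideanSpace.single i 1) =
      φ x + x i * fderiv ℝ φ x (EuclideanSpace.single i 1) := by
  have hcoord : HasFDerivAt (fun y : Space d => y i)
      (EuclideanSpace.proj i : Space d →L[ℝ] ℝ) x :=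
    (EuclideanSpace.proj i : Space d →L[ℝ] ℝ).hasFDerivAt
  rw [(hcoord.fun_mul (hφ x).hasFDerivAt).fderiv]
  simp
  ring

/-- `∫ φ² = -2 ∫ x_i φ ∂_i φ` for a compactly supported `C¹` function `φ`. -/
theorem integral_sq_eq_integral_coord_mul {φ : Space d → ℝ} (hφ : ContDiff ℝ 1 φ)
    (hs : HasCompactSupport φ) (i : Fin d) :
    ∫ x, φ x ^ 2 = -2 * ∫ x, x i * φ x * fderiv ℝ φ x (EuclideanSpace.single i 1) := by
  have hdiff : Differentiable ℝ φ := hφ.differentiable one_ne_zero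
  have hc1 := hφ.continuous
  have hc2 : Continuous fun x => fderiv ℝ φ x (EuclideanSpace.single i 1) :=
    (hφ.continuous_fderiv one_ne_zero).clm_apply continuous_const
  have hcd : Differentiable ℝ fun y : Space d => y i :=
    (EuclideanSpace.proj i : Space d →L[ℝ] ℝ).differentiable
  have hcs : HasCompactSupport fun x : Space d => x i * φ x := hs.mul_left
  have i1 : Integrable fun x => φ x ^ 2 := by
    simp only [sq]
    exact (hc1.mul hc1).integrable_of_hasCompactSupport hs.mul_right
  have i2 : Integrable fun x => x i * φ x * fderiv ℝ φ x (EuclideanSpace.single i 1) :=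
    ((hcd.continuous.mul hc1).mul hc2).integrable_of_hasCompactSupport hcs.mul_right
  have i3 : Integrable fun x => x i * φ x * φ x :=
    ((hcd.continuous.mul hc1).mul hc1).integrable_of_hasCompactSupport hcs.mul_right
  have hsum : ∀ x, fderiv ℝ (fun y : Space d => y i * φ y) x (EuclideanSpace.single i 1) * φ x =
      φ x ^ 2 + x i * φ x * fderiv ℝ φ x (EuclideanSpace.single i 1) := by
    intro x
    rw [fderiv_coord_mul hdiff]
    ring
  have i4 := (i1.add i2).congr (Filter.Eventually.of_forall fun x => (hsum x).symm)
  -- Integration by parts of `x_i φ` against `φ` in the direction `e_i`.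
  have key := integral_mul_fderiv_eq_neg_fderiv_mul_of_integrable i4 i2 i3
    (fun x _ => (hcd x).fun_mul (hdiff x)) (fun x _ => hdiff x)
  rw [integral_congr_ae (Filter.Eventually.of_forall hsum), integral_add i1 i2] at key
  linarith

theorem integral_test_sq (φ : 𝓓(Ω, ℝ)) (i : Fin d) :
    ∫ x in (Ω : Set (Space d)), φ x ^ 2 =
      ∫ x in (Ω : Set (Space d)),
        -2 * (x i * φ x * fderiv ℝ φ x (EuclideanSpace.single i 1)) := by
  rw [setIntegral_eq_integral_of_forall_compl_eq_zero
      (fun x hx => by rw [test_eq_zero_of_notMem φ hx]; simp),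
    setIntegral_eq_integral_of_forall_compl_eq_zero
      (fun x hx => by rw [test_eq_zero_of_notMem φ hx]; simp), integral_const_mul]
  exact integral_sq_eq_integral_coord_mul (φ.contDiff.of_le (by simp)) φ.hasCompactSupport i

theorem norm_toLp_sq {E : Type*} [NormedAddCommGroup E] [InnerProductSpace ℝ E]
    {α : Type*} [MeasurableSpace α] {ν : Measure α} {g : α → E} (hg : MemLp g 2 ν) :
    ‖hg.toLp g‖ ^ 2 = ∫ x, ‖g x‖ ^ 2 ∂ν := by
  rw [← real_inner_self_eq_norm_sq, L2.inner_def]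
  refine integral_congr_ae ?_
  filter_upwards [hg.coeFn_toLp] with x hx
  rw [hx, real_inner_self_eq_norm_sq]

/-- In `∫ φ² = -2 ∫ x_i φ ∂_i φ`, bound `|x_i|` by `R` and apply Young's inequality so that `½ ∫ φ²`
is absorbed on the left. -/
theorem norm_test_sq_le {R : ℝ} (hd : 0 < d) (hR : ∀ x ∈ Ω, ‖x‖ ≤ R) (φ : 𝓓(Ω, ℝ)) :
    ‖(test_memLp φ).toLp φ‖ ^ 2 ≤ 4 * R ^ 2 * ‖(test_gradient_memLp φ).toLp (∇ φ)‖ ^ 2 := by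
  rw [norm_toLp_sq, norm_toLp_sq]
  simp only [Real.norm_eq_abs, sq_abs]
  have i1 : Integrable (fun x => φ x ^ 2) (vol Ω) := (test_memLp φ).integrable_sq
  have i2 : Integrable (fun x => ‖∇ φ x‖ ^ 2) (vol Ω) :=
    (test_gradient_memLp φ).integrable_norm_pow two_ne_zero
  have hle : ∫ x in (Ω : Set (Space d)), φ x ^ 2 ≤
      ∫ x in (Ω : Set (Space d)), (1 / 2 * φ x ^ 2 + 2 * R ^ 2 * ‖∇ φ x‖ ^ 2) := by
    conv_lhs => rw [integral_test_sq φ ⟨0, hd⟩]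
    have i3 : Integrable (fun x => -2 * (x ⟨0, hd⟩ * φ x *
        fderiv ℝ φ x (EuclideanSpace.single ⟨0, hd⟩ 1))) (vol Ω) := by
      have hcc : Continuous fun y : Space d => y ⟨0, hd⟩ :=
        (EuclideanSpace.proj ⟨0, hd⟩ : Space d →L[ℝ] ℝ).continuous
      refine Integrable.const_mul (Integrable.restrict ?_) _
      exact ((hcc.mul φ.continuous).mul
        (test_continuous_fderiv_apply φ _)).integrable_of_hasCompactSupport
        ((φ.hasCompactSupport.mul_left).mul_right)
    refine integral_mono_ae i3 ((i1.const_mul _).add (i2.const_mul _)) ?_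
    filter_upwards [ae_restrict_mem Ω.isOpen.measurableSet] with x hx
    have h1 : |x ⟨0, hd⟩| ≤ R := (PiLp.norm_apply_le x _).trans (hR x hx)
    have h2 : |fderiv ℝ φ x (EuclideanSpace.single ⟨0, hd⟩ 1)| ≤ ‖∇ φ x‖ := by
      rw [fderiv_eq_inner_gradient]
      simpa using abs_real_inner_le_norm (∇ φ x) (EuclideanSpace.single ⟨0, hd⟩ (1 : ℝ))
    set t := x ⟨0, hd⟩
    set D := fderiv ℝ φ x (EuclideanSpace.single ⟨0, hd⟩ 1)
    have h3 : (t * D) ^ 2 ≤ (R * ‖∇ φ x‖) ^ 2 := by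
      rw [sq_le_sq, abs_mul]
      exact (mul_le_mul h1 h2 (abs_nonneg _) ((abs_nonneg _).trans h1)).trans (le_abs_self _)
    show -2 * (t * φ x * D) ≤ 1 / 2 * φ x ^ 2 + 2 * R ^ 2 * ‖∇ φ x‖ ^ 2
    nlinarith [sq_nonneg (φ x + 2 * (t * D))]
  rw [integral_add (i1.const_mul _) (i2.const_mul _), integral_const_mul, integral_const_mul] at hle
  linarith

/-- The estimate defines a closed set of pairs, so it passes from test functions to their closure.
-/
theorem norm_fst_le_of_mem_H10 {R : ℝ} (hd : 0 < d) (hR0 : 0 ≤ R) (hR : ∀ x ∈ Ω, ‖x‖ ≤ R)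
    (u : H10 Ω) : ‖(u : L2Pair Ω).fst‖ ≤ 2 * R * ‖grad u‖ := by
  have hcl : IsClosed {p : L2Pair Ω | ‖p.fst‖ ≤ 2 * R * ‖p.snd‖} :=
    isClosed_le (WithLp.continuous_fst ..).norm
      (continuous_const.mul (WithLp.continuous_snd ..).norm)
  have hsub : ((LinearMap.range (testPair Ω) : Submodule ℝ (L2Pair Ω)) : Set (L2Pair Ω)) ⊆
      {p : L2Pair Ω | ‖p.fst‖ ≤ 2 * R * ‖p.snd‖} := by
    rintro _ ⟨φ, rfl⟩
    refine le_of_sq_le_sq ?_ (mul_nonneg (by positivity) (norm_nonneg _))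
    exact (norm_test_sq_le hd hR φ).trans_eq
      (by rw [mul_pow, mul_pow, show (2 : ℝ) ^ 2 = 4 by norm_num1]; rfl)
  exact closure_minimal hsub hcl u.2

theorem exists_norm_le_grad (hd : 0 < d) (hΩ : Bornology.IsBounded (Ω : Set (Space d))) :
    ∃ C > 0, ∀ u : H10 Ω, ‖u‖ ^ 2 ≤ C * ‖grad u‖ ^ 2 := by
  obtain ⟨R, hR0, hR⟩ := hΩ.exists_pos_norm_le
  refine ⟨4 * R ^ 2 + 1, by positivity, fun u => ?_⟩
  have h := norm_fst_le_of_mem_H10 hd hR0.le hR u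
  have h1 : ‖u‖ ^ 2 = ‖(u : L2Pair Ω).fst‖ ^ 2 + ‖grad u‖ ^ 2 :=
    WithLp.prod_norm_sq_eq_of_L2 (u : L2Pair Ω)
  have h2 := pow_le_pow_left₀ (norm_nonneg _) h 2
  rw [h1]
  linarith [h2, mul_pow (2 * R) ‖grad u‖ 2, mul_pow 2 R 2]

end Poincare

/-! ### From distributions to the weak formulation on `H¹₀` -/

section WeakFormulation

variable {d : ℕ} {Ω : Opens (Space d)}

/-- The gradient as a continuous linear map `H¹₀(Ω) → L²(Ω; ℝ^d)`. -/
def gradCLM (Ω : Opens (Space d)) : H10 Ω →L[ℝ] L2Vec Ω :=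
  (WithLp.sndL 2 ℝ (L2 Ω) (L2Vec Ω)).comp (H10 Ω).subtypeL

theorem denseRange_testH10 : DenseRange (testH10 : 𝓓(Ω, ℝ) → H10 Ω) := by
  intro u
  rw [closure_subtype]
  have hu : (u : L2Pair Ω) ∈ closure (range (testPair Ω)) := u.2
  convert hu using 2
  ext p
  simp [testH10]

theorem inner_grad_testH10 (σ : L2Vec Ω) (φ : 𝓓(Ω, ℝ)) :
    inner ℝ σ (grad (testH10 φ)) = ∫ x in (Ω : Set (Space d)), inner ℝ (σ x) (∇ φ x) := by
  rw [L2.inner_def]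
  refine integral_congr_ae ?_
  filter_upwards [(test_gradient_memLp φ).coeFn_toLp] with x hx
  have : (grad (testH10 φ) : Space d → Space d) x = ∇ φ x := hx
  rw [this]

/-- Both sides are continuous in `v`, and test functions are dense. -/
theorem negDivEq_iff_forall_inner_grad (σ : L2Vec Ω) (f : Hneg1 Ω) :
    NegDivEq Ω σ f ↔ ∀ v : H10 Ω, inner ℝ σ (grad v) = f v := by
  simp only [NegDivEq, ← inner_grad_testH10]
  refine ⟨fun h v => ?_, fun h φ => h _⟩
  refine congr_fun (DenseRange.equalizer (f := testH10) (g := fun v => inner ℝ σ (grad v)) (h := f)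
    denseRange_testH10 ?_ f.continuous (funext h)) v
  exact continuous_const.inner (gradCLM Ω).continuous

theorem NegDivEq.congr_ae {σ τ : Space d → Space d} {f : Hneg1 Ω} (h : σ =ᵐ[vol Ω] τ) :
    NegDivEq Ω σ f ↔ NegDivEq Ω τ f := by
  refine forall_congr' fun φ => ?_
  rw [integral_congr_ae (g := fun x => inner ℝ (τ x) (∇ φ x))]
  filter_upwards [h] with x hx
  rw [hx]

end WeakFormulation

/-! ### Bounded weights: Lax–Milgram and the complementary energy -/

section Weight

variable {d : ℕ} {Ω : Opens (Space d)} {a : Space d → ℝ} {α β : ℝ}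

/-- Multiplication by an essentially bounded function on `L²(Ω; ℝ^d)`. -/
def mulCLM (ha : MemLp a ∞ (vol Ω)) : L2Vec Ω →L[ℝ] L2Vec Ω :=
  (ContinuousLinearMap.lsmul ℝ ℝ : ℝ →L[ℝ] Space d →L[ℝ] Space d).holderL (vol Ω) ∞ 2 2
    (ha.toLp a)

theorem coeFn_mulCLM (ha : MemLp a ∞ (vol Ω)) (τ : L2Vec Ω) :
    mulCLM ha τ =ᵐ[vol Ω] fun x => a x • τ x := by
  filter_upwards [(ContinuousLinearMap.lsmul ℝ ℝ : ℝ →L[ℝ] Space d →L[ℝ] Space d).coeFn_holder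
    (r := 2) (ha.toLp a) τ, ha.coeFn_toLp] with x hx hx'
  rw [← hx', ← ContinuousLinearMap.lsmul_apply ℝ ℝ]
  exact hx

theorem integrable_mul_norm_sq (ha : MemLp a ∞ (vol Ω)) (τ : L2Vec Ω) :
    Integrable (fun x => a x * ‖τ x‖ ^ 2) (vol Ω) := by
  refine (L2.integrable_inner (𝕜 := ℝ) (mulCLM ha τ) τ).congr ?_
  filter_upwards [coeFn_mulCLM ha τ] with x hx
  rw [hx, real_inner_smul_left, real_inner_self_eq_norm_sq]

theorem inner_mulCLM_self (ha : MemLp a ∞ (vol Ω)) (τ : L2Vec Ω) :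
    inner ℝ (mulCLM ha τ) τ = ∫ x in (Ω : Set (Space d)), a x * ‖τ x‖ ^ 2 := by
  rw [L2.inner_def]
  refine integral_congr_ae ?_
  filter_upwards [coeFn_mulCLM ha τ] with x hx
  rw [hx, real_inner_smul_left, real_inner_self_eq_norm_sq]

/-- Serves twice: with `a` for coercivity, and with `a⁻¹` for uniqueness of the minimizer. -/
theorem mul_norm_sq_le_integral (ha : MemLp a ∞ (vol Ω)) (h : ∀ᵐ x ∂(vol Ω), α ≤ a x)
    (τ : L2Vec Ω) : α * ‖τ‖ ^ 2 ≤ ∫ x in (Ω : Set (Space d)), a x * ‖τ x‖ ^ 2 := by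
  have hτ : Integrable (fun x => ‖τ x‖ ^ 2) (vol Ω) :=
    (Lp.memLp τ).integrable_norm_pow two_ne_zero
  rw [← Lp.toLp_coeFn τ (Lp.memLp τ), norm_toLp_sq, Lp.toLp_coeFn, ← integral_const_mul]
  refine integral_mono_ae (hτ.const_mul α) (integrable_mul_norm_sq ha τ) ?_
  filter_upwards [h] with x hx
  exact mul_le_mul_of_nonneg_right hx (by positivity)

theorem existsUnique_weak_solution (hd : 0 < d) (hΩ : Bornology.IsBounded (Ω : Set (Space d)))
    (ha : MemLp a ∞ (vol Ω)) (hα : 0 < α) (h : ∀ᵐ x ∂(vol Ω), α ≤ a x) (f : Hneg1 Ω) :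
    ∃! u : H10 Ω, ∀ v : H10 Ω, inner ℝ (mulCLM ha (grad u)) (grad v) = f v := by
  have : CompleteSpace (H10 Ω) :=
    (Submodule.isClosed_topologicalClosure _).completeSpace_coe
  obtain ⟨C, hC, hCu⟩ := exists_norm_le_grad hd hΩ
  let B : H10 Ω →L[ℝ] H10 Ω →L[ℝ] ℝ :=
    (innerSL ℝ).bilinearComp ((mulCLM ha).comp (gradCLM Ω)) (gradCLM Ω)
  have hB : ∀ u v, B u v = inner ℝ (mulCLM ha (grad u)) (grad v) := fun _ _ => rfl
  have hco : IsCoercive B := by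
    -- `α` bounds the weight below and `C` is the Poincaré constant.
    refine ⟨α / C, by positivity, fun u => ?_⟩
    rw [hB, inner_mulCLM_self]
    refine le_trans ?_ (mul_norm_sq_le_integral ha h (grad u))
    rw [div_mul_eq_mul_div, div_mul_eq_mul_div, div_le_iff₀ hC]
    nlinarith [hCu u]
  simp only [← hB]
  have hu : ∀ u v, B u v = f v ↔
      inner ℝ (hco.continuousLinearEquivOfBilin u) v =
        inner ℝ ((InnerProductSpace.toDual ℝ (H10 Ω)).symm f) v := by
    intro u v
    rw [hco.continuousLinearEquivOfBilin_apply, InnerProductSpace.toDual_symm_apply]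
  refine ⟨hco.continuousLinearEquivOfBilin.symm
    ((InnerProductSpace.toDual ℝ (H10 Ω)).symm f), fun v => (hu _ v).2 (by simp), ?_⟩
  intro w hw
  rw [ContinuousLinearEquiv.eq_symm_apply]
  exact ext_inner_right ℝ fun v => (hu w v).1 (hw v)

/-- Expansion of the complementary energy `∫ |τ|² / a` around the flux `a ∇u` of the state `u`. -/
theorem integral_flux_expansion (ha : MemLp a ∞ (vol Ω)) (ha' : MemLp (fun x => (a x)⁻¹) ∞ (vol Ω))
    (hpos : ∀ᵐ x ∂(vol Ω), 0 < a x) {f : Hneg1 Ω} {u : H10 Ω}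
    (hu : NegDivEq Ω (mulCLM ha (grad u)) f) {τ : L2Vec Ω} (hτ : NegDivEq Ω τ f) :
    ∫ x in (Ω : Set (Space d)), ‖τ x‖ ^ 2 / a x =
      f u + ∫ x in (Ω : Set (Space d)), (a x)⁻¹ * ‖(τ - mulCLM ha (grad u)) x‖ ^ 2 := by
  rw [negDivEq_iff_forall_inner_grad] at hu hτ
  -- The completed square, with `a∇u` as centre.
  have e : (fun x => ‖τ x‖ ^ 2 / a x) =ᵐ[vol Ω]
      fun x => 2 * inner ℝ (τ x) (grad u x) - inner ℝ (mulCLM ha (grad u) x) (grad u x)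
        + (a x)⁻¹ * ‖(τ - mulCLM ha (grad u)) x‖ ^ 2 := by
    filter_upwards [hpos, coeFn_mulCLM ha (grad u), Lp.coeFn_sub τ (mulCLM ha (grad u))]
      with x hx h1 h2
    rw [h2, Pi.sub_apply, h1, norm_sub_sq_real, norm_smul, real_inner_smul_right,
      real_inner_smul_left, real_inner_self_eq_norm_sq, mul_pow, Real.norm_eq_abs, sq_abs]
    field_simp
    ring
  have i1 := L2.integrable_inner (𝕜 := ℝ) τ (grad u)
  have i2 := L2.integrable_inner (𝕜 := ℝ) (mulCLM ha (grad u)) (grad u)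
  have i3 : Integrable (fun x => 2 * inner ℝ (τ x) (grad u x) -
      inner ℝ (mulCLM ha (grad u) x) (grad u x)) (vol Ω) := (i1.const_mul 2).sub i2
  rw [integral_congr_ae e, integral_add i3 (integrable_mul_norm_sq ha' _),
    integral_sub (i1.const_mul 2) i2, integral_const_mul, ← L2.inner_def, ← L2.inner_def, hu, hτ]
  ring

end Weight

/-! ### Uniform bounds on `λ₋` -/

section Materials

variable {d N : ℕ} {M : Fin N → Matrix (Fin d) (Fin d) ℝ}

theorem minEigenvalue_pos (hd : 0 < d) {A : Matrix (Fin d) (Fin d) ℝ} (hA : A.PosDef) :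
    0 < minEigenvalue hA.isHermitian := by
  have : Nonempty (Fin d) := ⟨⟨0, hd⟩⟩
  obtain ⟨k, hk⟩ := exists_eq_ciInf_of_finite (f := hA.isHermitian.eigenvalues)
  rw [minEigenvalue, ← hk]
  exact hA.eigenvalues_pos k

theorem exists_lambdaMinus_bounds (hd : 0 < d) (hM : ∀ j, (M j).PosDef) :
    ∃ α β : ℝ, 0 < α ∧ 0 < β ∧ ∀ ϑ ∈ stdSimplex ℝ (Fin N),
      α ≤ lambdaMinus hM ϑ ∧ lambdaMinus hM ϑ ≤ β := by
  set c : Fin N → ℝ := fun j => minEigenvalue (hM j).isHermitian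
  have hcpos : ∀ j, 0 < c j := fun j => minEigenvalue_pos hd (hM j)
  -- The summand `1` keeps both bounds positive even when `N = 0` and the sums are empty.
  have hS : 0 < 1 + ∑ j, (c j)⁻¹ :=
    add_pos_of_pos_of_nonneg one_pos (Finset.sum_nonneg fun j _ => (inv_pos.2 (hcpos j)).le)
  have hT : 0 < 1 + ∑ j, c j :=
    add_pos_of_pos_of_nonneg one_pos (Finset.sum_nonneg fun j _ => (hcpos j).le)
  refine ⟨(1 + ∑ j, (c j)⁻¹)⁻¹, 1 + ∑ j, c j, inv_pos.2 hS, hT, fun ϑ hϑ => ?_⟩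
  have hlow : (1 + ∑ j, c j)⁻¹ ≤ ∑ j, ϑ j / c j := by
    have h1 : (1 + ∑ j, c j)⁻¹ = ∑ j, ϑ j * (1 + ∑ j, c j)⁻¹ := by
      rw [← Finset.sum_mul, hϑ.2, one_mul]
    rw [h1]
    refine Finset.sum_le_sum fun j _ => ?_
    rw [div_eq_mul_inv]
    refine mul_le_mul_of_nonneg_left (inv_anti₀ (hcpos j) ?_) (hϑ.1 j)
    linarith [Finset.single_le_sum (fun i _ => (hcpos i).le) (Finset.mem_univ j)]
  have hup : ∑ j, ϑ j / c j ≤ 1 + ∑ j, (c j)⁻¹ := by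
    have : ∑ j, ϑ j / c j ≤ ∑ j, (c j)⁻¹ := by
      refine Finset.sum_le_sum fun j _ => ?_
      have h1 : ϑ j ≤ 1 := by
        rw [← hϑ.2]
        exact Finset.single_le_sum (fun i _ => hϑ.1 i) (Finset.mem_univ j)
      rw [div_eq_mul_inv]
      exact mul_le_of_le_one_left (inv_pos.2 (hcpos j)).le h1
    linarith
  have hpos : 0 < ∑ j, ϑ j / c j := (inv_pos.2 hT).trans_le hlow
  exact ⟨inv_anti₀ hpos hup, inv_le_of_inv_le₀ hT hlow⟩

theorem aestronglyMeasurable_lambdaMinus {Ω : Opens (Space d)} (hM : ∀ j, (M j).PosDef)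
    {θ : Space d → Fin N → ℝ} (hθ : AEStronglyMeasurable θ (vol Ω)) :
    AEStronglyMeasurable (fun x => lambdaMinus hM (θ x)) (vol Ω) := by
  have hj : ∀ j, AEMeasurable (fun x => θ x j) (vol Ω) := fun j =>
    (measurable_pi_apply j).comp_aemeasurable hθ.aemeasurable
  unfold lambdaMinus
  exact (Finset.aemeasurable_fun_sum _ fun j _ => (hj j).div_const _).inv.aestronglyMeasurable

end Materials

end OptDesign

end


/-! ### The dual minimum principle -/

theorem lemma3p1 {d N m : ℕ} (hd : 0 < d)
    (Ω : TopologicalSpace.Opens (OptDesign.Space d))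
    (hΩ : Bornology.IsBounded (Ω : Set (OptDesign.Space d)))
    (M : Fin N → Matrix (Fin d) (Fin d) ℝ) (hM : ∀ j, (M j).PosDef)
    (q : Fin N → ℝ)
    (hq : ∑ j, q j = (volume : Measure (OptDesign.Space d)).real (Ω : Set (OptDesign.Space d)))
    (f : Fin m → OptDesign.Hneg1 Ω) (μ : Fin m → ℝ) (hμ : ∀ i, 0 < μ i)
    (θ : OptDesign.Space d → Fin N → ℝ) (hθ : OptDesign.IsAdmissible Ω q θ) :
    -- the state equations are uniquely solvable, so that `I(θ)` is well defined
    (∀ i, ∃! u : OptDesign.H10 Ω, OptDesign.IsState Ω hM θ (f i) u) ∧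
    -- the integrals in the flux energy are finite
    (∀ τ : OptDesign.L2Vec Ω, Integrable
      (fun x => ‖τ x‖ ^ 2 / OptDesign.lambdaMinus hM (θ x)) (OptDesign.vol Ω)) ∧
    ∀ u : Fin m → OptDesign.H10 Ω, (∀ i, OptDesign.IsState Ω hM θ (f i) (u i)) →
      -- `I(θ)` is the minimum of the flux energy over the admissible fluxes
      IsLeast (OptDesign.fluxEnergy Ω hM μ θ '' OptDesign.fluxes Ω f)
        (OptDesign.energy Ω μ f u) ∧
      -- the minimum is attained exactly at `σ_i = λ₋(θ) ∇u_i`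
      ∃ σ ∈ OptDesign.fluxes Ω f,
        (∀ i, ∀ᵐ x ∂(OptDesign.vol Ω),
          σ i x = OptDesign.lambdaMinus hM (θ x) • OptDesign.grad (u i) x) ∧
        OptDesign.fluxEnergy Ω hM μ θ σ = OptDesign.energy Ω μ f u ∧
        ∀ τ ∈ OptDesign.fluxes Ω f,
          OptDesign.fluxEnergy Ω hM μ θ τ = OptDesign.energy Ω μ f u → τ = σ := by
  obtain ⟨α, β, hα, hβ, hb⟩ := OptDesign.exists_lambdaMinus_bounds hd hM
  set a : OptDesign.Space d → ℝ := fun x => OptDesign.lambdaMinus hM (θ x)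
  have hmeas : AEStronglyMeasurable a (OptDesign.vol Ω) :=
    OptDesign.aestronglyMeasurable_lambdaMinus hM hθ.1
  have hlow : ∀ᵐ x ∂(OptDesign.vol Ω), α ≤ a x := hθ.2.1.mono fun x hx => (hb _ hx).1
  have hup : ∀ᵐ x ∂(OptDesign.vol Ω), a x ≤ β := hθ.2.1.mono fun x hx => (hb _ hx).2
  have hpos : ∀ᵐ x ∂(OptDesign.vol Ω), 0 < a x := hlow.mono fun x hx => hα.trans_le hx
  have hinv : ∀ᵐ x ∂(OptDesign.vol Ω), β⁻¹ ≤ (a x)⁻¹ := by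
    filter_upwards [hpos, hup] with x h1 h2
    exact inv_anti₀ h1 h2
  have ha : MemLp a ∞ (OptDesign.vol Ω) := by
    refine memLp_top_of_bound hmeas β ?_
    filter_upwards [hpos, hup] with x h1 h2
    rwa [Real.norm_of_nonneg h1.le]
  have ha' : MemLp (fun x => (a x)⁻¹) ∞ (OptDesign.vol Ω) := by
    refine memLp_top_of_bound hmeas.aemeasurable.inv.aestronglyMeasurable α⁻¹ ?_
    filter_upwards [hpos, hlow] with x h1 h2
    rw [Real.norm_of_nonneg (inv_pos.2 h1).le]
    exact inv_anti₀ hα h2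
  have hstate : ∀ (g : OptDesign.Hneg1 Ω) (w : OptDesign.H10 Ω),
      OptDesign.IsState Ω hM θ g w ↔
        OptDesign.NegDivEq Ω (OptDesign.mulCLM ha (OptDesign.grad w)) g := fun g w =>
    (OptDesign.NegDivEq.congr_ae (OptDesign.coeFn_mulCLM ha (OptDesign.grad w))).symm
  refine ⟨fun i => ?_, fun τ => ?_, fun u hu => ?_⟩
  · simp only [hstate, OptDesign.negDivEq_iff_forall_inner_grad]
    exact OptDesign.existsUnique_weak_solution hd hΩ ha hα hlow (f i)
  · refine (OptDesign.integrable_mul_norm_sq ha' τ).congr (Filter.Eventually.of_forall fun x => ?_)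
    simp only [div_eq_inv_mul, a]
  set σ : Fin m → OptDesign.L2Vec Ω := fun i => OptDesign.mulCLM ha (OptDesign.grad (u i))
  have hσ : σ ∈ OptDesign.fluxes Ω f := fun i => (hstate _ _).1 (hu i)
  have hexp : ∀ τ ∈ OptDesign.fluxes Ω f, OptDesign.fluxEnergy Ω hM μ θ τ =
      OptDesign.energy Ω μ f u + ∑ i, μ i *
        ∫ x in (Ω : Set (OptDesign.Space d)), (a x)⁻¹ * ‖(τ i - σ i) x‖ ^ 2 := by
    intro τ hτ
    rw [OptDesign.fluxEnergy, OptDesign.energy, ← Finset.sum_add_distrib]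
    refine Finset.sum_congr rfl fun i _ => ?_
    rw [← mul_add]
    exact congrArg _ (OptDesign.integral_flux_expansion ha ha' hpos (hσ i) (hτ i))
  -- The upper bound `a ≤ β` makes the remainder control the `L²` distance to `σ`.
  have hge : ∀ τ : Fin m → OptDesign.L2Vec Ω, ∀ i, β⁻¹ * ‖τ i - σ i‖ ^ 2 ≤
      ∫ x in (Ω : Set (OptDesign.Space d)), (a x)⁻¹ * ‖(τ i - σ i) x‖ ^ 2 := fun τ i =>
    OptDesign.mul_norm_sq_le_integral ha' hinv _
  have hnn : ∀ τ : Fin m → OptDesign.L2Vec Ω, ∀ i, 0 ≤ μ i *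
      ∫ x in (Ω : Set (OptDesign.Space d)), (a x)⁻¹ * ‖(τ i - σ i) x‖ ^ 2 := fun τ i =>
    mul_nonneg (hμ i).le (le_trans (by positivity) (hge τ i))
  have hσE : OptDesign.fluxEnergy Ω hM μ θ σ = OptDesign.energy Ω μ f u := by
    rw [hexp σ hσ, add_eq_left]
    refine Finset.sum_eq_zero fun i _ => mul_eq_zero_of_right _ ?_
    refine integral_eq_zero_of_ae ?_
    rw [sub_self]
    filter_upwards [Lp.coeFn_zero (OptDesign.Space d) 2 (OptDesign.vol Ω)] with x hx
    rw [hx]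
    simp
  refine ⟨⟨⟨σ, hσ, hσE⟩, ?_⟩, σ, hσ, fun i => OptDesign.coeFn_mulCLM ha _, hσE, ?_⟩
  · rintro _ ⟨τ, hτ, rfl⟩
    rw [hexp τ hτ]
    exact le_add_of_nonneg_right (Finset.sum_nonneg fun i _ => hnn τ i)
  · intro τ hτ hE
    -- Equality of energies forces every nonnegative remainder to vanish.
    rw [hexp τ hτ, add_eq_left, Finset.sum_eq_zero_iff_of_nonneg fun i _ => hnn τ i] at hE
    funext i
    have h0 := (mul_eq_zero.1 (hE i (Finset.mem_univ i))).resolve_left (hμ i).ne'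
    have h1 := hge τ i
    rw [h0] at h1
    have h2 : ‖τ i - σ i‖ ^ 2 ≤ 0 := nonpos_of_mul_nonpos_right h1 (inv_pos.2 hβ)
    exact sub_eq_zero.1 (norm_eq_zero.1 (pow_eq_zero_iff two_ne_zero |>.1 (le_antisymm h2 (sq_nonneg _))))
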